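/- Let $\mathcal C=(\mathcal C,\otimes,1)$ be a monoidal category. An object $K$ of $\mathcal C$ is \emph{dualizing} if for every $Y\in\mathcal C$ the functor $\operatorname{Hom}_{\mathcal C}(-\otimes Y,K)$ is representable by an object $DY$ and the induced contravariant functor $D$ is an antiequivalence of $\mathcal C$. A \emph{Grothendieck-Verdier (GV) category} is a monoidal category with a chosen dualizing object $K$; it is automatically closed, with right adjoints $X\multimap{?}$ of $X\otimes{?}$ and ${?}/X$ of ${?}\otimes X$, and we write $D'(X)=X\multimap K$, $D(X)=K/X$. It is \emph{braided} if its underlying monoidal category is equipped with a braiding. For a lax monoidal functor $F\colon(\mathcal C,K)\to(\mathcal D,k)$ between GV-categories, a morphism $\upsilon\colon F(K)\to k$ is a \emph{Frobenius form} if the two families of morphisms $$F(X\multimap K)\to F(X)\multimap k,\qquad F(K/X)\to k/F(X)\qquad(X\in\mathcal C)$$ that are the transposes of $F(X)\otimes F(X\multimap K)\to F(X\otimes(X\multimap K))\to F(K)\xrightarrow{\upsilon}k$ and of $F(K/X)\otimes F(X)\to F((K/X)\otimes X)\to F(K)\xrightarrow{\upsilon}k$ consist of isomorphisms. A \emph{GV-functor}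 is a lax monoidal functor equipped with a Frobenius form; a GV-functor between braided GV-categories is \emph{braided} if its underlying lax monoidal functor is braided. \textbf{Proposition.} Let $\mathcal C$ be a braided GV-category with braiding $c$ and dualizing object $K$, and suppose that $\mathcal C$ admits equalizers and coequalizers. Let $A=(A,\mu,\eta)$ be a commutative (unital associative) algebra in $(\mathcal C,\otimes,1)$. A left $A$-module $(M,l\colon A\otimes M\to M)$ is called local if $l=l\circ c_{M,A}\circ c_{A,M}$. The full subcategory ${}_A\mathcal C^{\mathrm{loc}}$ of local left $A$-modules is a monoidal category with unit $A$ and product $M\otimes_A N$, the coequalizer of the two actions $M\otimes A\otimes N\rightrightarrows M\otimes N$ (where $A$ acts on $M$ from the right by $l\circ c_{M,A}$), and the forgetful functor $U\colon{}_A\mathcal C^{\mathrm{loc}}\to\mathcal C$ is lax monoidal via $\eta\colon1\to A$ and the projections $M\otimes N\to M\otimes_A N$. Let $D'(A)=A\multimap K$ carry the left $A$-action given by $A\to A\multimap A$ (the transpose of $\mu$) followed by the internal composition $(A\multimap A)\otimes(A\multimap K)\to A\multimap K$. If the $A$-module $D'(A)$ is local, then ${}_A\mathcal C^{\mathrm{loc}}$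 admits a braiding and a GV-structure with dualizing object $D'(A)$, making it a braided GV-category, such that $U$, equipped with the form $D'(\eta)\colon U(D'(A))=D'(A)\to D'(1)\cong K$, is a braided GV-functor. -/

import Mathlib

open CategoryTheory MonoidalCategory Limits

universe v u

namespace GVCat

section Closed
variable {C : Type u} [Category.{v} C] [MonoidalCategory C] [MonoidalClosed C]

instance preservesTensorLeft (X : C) : PreservesColimitsOfSize.{0, 0} (tensorLeft X) :=
  (ihom.adjunction X).leftAdjoint_preservesColimits

instance preservesTensorRight [BraidedCategory C] (X : C) :
    PreservesColimitsOfSize.{0, 0} (tensorRight X) :=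
  preservesColimits_of_natIso (BraidedCategory.tensorLeftIsoTensorRight X)

end Closed

section Bim
variable {C : Type u} [Category.{v} C] [MonoidalCategory C] [HasCoequalizers C]
  [∀ X : C, PreservesColimitsOfSize.{0, 0} (tensorLeft X)]
  [∀ X : C, PreservesColimitsOfSize.{0, 0} (tensorRight X)]

/-- `A`-bimodules with the relative tensor product `⊗_A` and unit `A`. -/
noncomputable instance bimodMonoidal (A : Mon C) : MonoidalCategory (Bimod A A) where
  tensorObj M N := M.tensorBimod N
  whiskerLeft M _ _ f := Bimod.whiskerLeft M f
  whiskerRight f N := Bimod.whiskerRight f N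
  tensorUnit := Bimod.regular A
  associator M N P := Bimod.associatorBimod M N P
  leftUnitor M := Bimod.leftUnitorBimod M
  rightUnitor M := Bimod.rightUnitorBimod M
  tensorHom_def _ _ := rfl
  id_tensorHom_id _ _ := by
    rw [Bimod.id_whiskerRight_bimod, Bimod.whiskerLeft_id_bimod, Category.comp_id]
  tensorHom_comp_tensorHom f₁ f₂ g₁ g₂ := by
    simp only [Bimod.comp_whiskerRight_bimod, Bimod.whiskerLeft_comp_bimod, Category.assoc]
    rw [← Category.assoc (Bimod.whiskerLeft _ _) (Bimod.whiskerRight _ _),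
      Bimod.whisker_exchange_bimod]
    simp only [Category.assoc]
  whiskerLeft_id _ _ := Bimod.whiskerLeft_id_bimod
  id_whiskerRight _ _ := Bimod.id_whiskerRight_bimod
  associator_naturality f₁ f₂ f₃ := by
    simp only [Bimod.comp_whiskerRight_bimod, Bimod.whiskerLeft_comp_bimod,
      Bimod.whisker_assoc_bimod, Bimod.comp_whiskerLeft_bimod, Bimod.whiskerRight_comp_bimod,
      Category.assoc, Iso.inv_hom_id, Iso.hom_inv_id_assoc, Iso.inv_hom_id_assoc, Category.comp_id]
  leftUnitor_naturality f := by
    have := Bimod.id_whiskerLeft_bimod f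
    rw [this]; simp
  rightUnitor_naturality f := by
    have := Bimod.whiskerRight_id_bimod f
    rw [this]; simp
  pentagon := Bimod.pentagon_bimod
  triangle := Bimod.triangle_bimod

/-- The projection `M ⊗ N ⟶ M ⊗_A N` from the coequalizer defining `M ⊗_A N`. -/
noncomputable def bimodProj {A : Mon C} (M N : Bimod A A) : M.X ⊗ N.X ⟶ (M ⊗ N).X :=
  coequalizer.π (M.actRight ▷ N.X) ((α_ _ _ _).hom ≫ M.X ◁ N.actLeft)

section
variable {A : Mon C} (M N P : Bimod A A)

lemma bimodProj_condition : M.actRight ▷ N.X ≫ bimodProj M N =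
    (α_ _ _ _).hom ≫ M.X ◁ N.actLeft ≫ bimodProj M N := by
  rw [← Category.assoc]
  exact coequalizer.condition (M.actRight ▷ N.X) ((α_ _ _ _).hom ≫ M.X ◁ N.actLeft)

instance : Epi (bimodProj M N) := by unfold bimodProj; exact coequalizer.π_epi

instance (Z : C) : Epi (Z ◁ bimodProj M N) := by
  have : Epi ((tensorLeft Z).map (coequalizer.π (M.actRight ▷ N.X) ((α_ _ _ _).hom ≫ M.X ◁ N.actLeft))) :=
    inferInstance
  exact this

instance (Z : C) : Epi (bimodProj M N ▷ Z) := by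
  have : Epi ((tensorRight Z).map (coequalizer.π (M.actRight ▷ N.X) ((α_ _ _ _).hom ≫ M.X ◁ N.actLeft))) :=
    inferInstance
  exact this

lemma bimodProj_actLeft : A.X ◁ bimodProj M N ≫ (M ⊗ N).actLeft =
    (α_ _ _ _).inv ≫ M.actLeft ▷ N.X ≫ bimodProj M N :=
  Bimod.TensorBimod.whiskerLeft_π_actLeft M N

lemma bimodProj_actRight : bimodProj M N ▷ A.X ≫ (M ⊗ N).actRight =
    (α_ _ _ _).hom ≫ M.X ◁ N.actRight ≫ bimodProj M N :=
  Bimod.TensorBimod.π_tensor_id_actRight M N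

lemma bimodProj_whiskerLeft {N N' : Bimod A A} (f : N ⟶ N') :
    bimodProj M N ≫ (M ◁ f).hom = M.X ◁ f.hom ≫ bimodProj M N' :=
  ι_colimMap _ _

lemma bimodProj_whiskerRight {M M' : Bimod A A} (f : M ⟶ M') (N : Bimod A A) :
    bimodProj M N ≫ (f ▷ N).hom = f.hom ▷ N.X ≫ bimodProj M' N :=
  ι_colimMap _ _

lemma bimodProj_associator :
    bimodProj M N ▷ P.X ≫ bimodProj (M ⊗ N) P ≫ (α_ M N P).hom.hom =
      (α_ M.X N.X P.X).hom ≫ M.X ◁ bimodProj N P ≫ bimodProj M (N ⊗ P) := by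
  have h : bimodProj (M ⊗ N) P ≫ (α_ M N P).hom.hom = Bimod.AssociatorBimod.homAux M N P :=
    coequalizer.π_desc _ _
  rw [h]
  exact π_tensor_id_preserves_coequalizer_inv_desc _ _ _ _

lemma bimodProj_leftUnitor : bimodProj (𝟙_ _) M ≫ (λ_ M).hom.hom = M.actLeft :=
  coequalizer.π_desc _ _

lemma bimodProj_rightUnitor : bimodProj M (𝟙_ _) ≫ (ρ_ M).hom.hom = M.actRight :=
  coequalizer.π_desc _ _

noncomputable instance bimodForget (A : Mon C) :
    (Bimod.forget A (B := A)).LaxMonoidal where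
  ε := MonObj.one (X := A.X)
  μ M N := bimodProj M N
  μ_natural_left f N := (bimodProj_whiskerRight f N).symm
  μ_natural_right M f := (bimodProj_whiskerLeft M f).symm
  associativity M N P := bimodProj_associator M N P
  left_unitality M := by
    refine (M.one_actLeft).symm.trans ?_
    exact congrArg _ (bimodProj_leftUnitor M).symm
  right_unitality M := by
    refine (M.actRight_one).symm.trans ?_
    exact congrArg _ (bimodProj_rightUnitor M).symm

end
end Bim

section Br
variable {C : Type u} [Category.{v} C] [MonoidalCategory C]

open scoped MonObj

/-- The action `A ⊗ X ⟶ X` of a left `A`-module `X`. -/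
abbrev act (A : C) [MonObj A] (X : C) [ModObj A X] : A ⊗ X ⟶ X := γ[A, X]

lemma one_act (A : C) [MonObj A] (X : C) [ModObj A X] : η[A] ▷ X ≫ act A X = (λ_ X).hom :=
  ModObj.one_smul_self A X

lemma mul_act (A : C) [MonObj A] (X : C) [ModObj A X] :
    μ[A] ▷ X ≫ act A X = (α_ A A X).hom ≫ A ◁ act A X ≫ act A X :=
  ModObj.mul_smul_self A X

lemma act_hom {A : C} [MonObj A] {M N : Mod C A} (f : M ⟶ N) :
    act A M.X ≫ f.hom = A ◁ f.hom ≫ act A N.X :=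
  IsModHom.smul_hom (A := A) (f := f.hom)

lemma id_whiskerLeft_comp {X Y Z : C} (f : Z ⊗ X ⟶ Y) : Z ◁ 𝟙 X ≫ f = f := by simp

lemma id_whiskerRight_comp {X Y Z : C} (f : X ⊗ Z ⟶ Y) : 𝟙 X ▷ Z ≫ f = f := by simp

variable [BraidedCategory C]

lemma balanced_right (A : C) [MonObj A] {M N Q : C} [ModObj A M] [ModObj A N] (p : M ⊗ N ⟶ Q)
    (h : ((β_ M A).hom ≫ act A M) ▷ N ≫ p = (α_ M A N).hom ≫ M ◁ act A N ≫ p) :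
    (α_ M N A).hom ≫ M ◁ ((β_ N A).hom ≫ act A N) ≫ p =
      (β_ (M ⊗ N) A).hom ≫ (α_ A M N).inv ≫ act A M ▷ N ≫ p := by
  rw [BraidedCategory.braiding_tensor_left_hom]
  simp only [comp_whiskerRight, Category.assoc, Iso.hom_inv_id_assoc, whiskerLeft_comp] at h ⊢
  rw [h]
  simp

variable (A : C) [MonObj A] [IsCommMonObj A]

lemma braid_act_middle (X : C) [ModObj A X] :
    act A X ▷ A ≫ (β_ X A).hom ≫ act A X =
      (α_ A X A).hom ≫ A ◁ ((β_ X A).hom ≫ act A X) ≫ act A X := by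
  have h : A ◁ act A X ≫ act A X = (α_ A A X).inv ≫ μ[A] ▷ X ≫ act A X := by simp
  rw [BraidedCategory.braiding_naturality_left_assoc, h,
    BraidedCategory.braiding_tensor_left_hom]
  simp only [whiskerLeft_comp, Category.assoc, h, Iso.hom_inv_id_assoc]
  rw [← comp_whiskerRight_assoc, IsCommMonObj.mul_comm]

lemma braid_act_assoc (X : C) [ModObj A X] :
    X ◁ μ[A] ≫ (β_ X A).hom ≫ act A X = (α_ X A A).inv ≫
      ((β_ X A).hom ≫ act A X) ▷ A ≫ (β_ X A).hom ≫ act A X := by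
  have h : A ◁ act A X ≫ act A X = (α_ A A X).inv ≫ μ[A] ▷ X ≫ act A X := by simp
  rw [comp_whiskerRight, Category.assoc, braid_act_middle,
    BraidedCategory.braiding_naturality_right_assoc, whiskerLeft_comp, Category.assoc, h,
    BraidedCategory.braiding_tensor_right_hom]
  simp

/-- The `A`-bimodule of a left `A`-module `M`: the right action is the braiding `c_{M,A}` followed by
the left action. (On local modules the inverse braiding gives the same right action.) -/
@[simps]
def toBimod : Mod C A ⥤ Bimod (Mon.mk A) (Mon.mk A) where
  obj M :=
    { X := M.X
      actLeft := act A M.X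
      actRight := (β_ M.X A).hom ≫ act A M.X
      one_actLeft := one_act A M.X
      left_assoc := mul_act A M.X
      actRight_one := by
        rw [BraidedCategory.braiding_naturality_right_assoc, one_act, braiding_leftUnitor]
      right_assoc := braid_act_assoc A M.X
      middle_assoc := braid_act_middle A M.X }
  map f :=
    { hom := f.hom
      left_act_hom := act_hom f
      right_act_hom := by
        rw [BraidedCategory.braiding_naturality_left_assoc, ← act_hom, Category.assoc] }

instance : (toBimod A).Faithful where
  map_injective h := Mod.hom_ext _ _ (congrArg Bimod.Hom.hom h)

instance : (toBimod A).Full where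
  map_surjective g := ⟨Mod.Hom.mk' g.hom g.left_act_hom, rfl⟩

variable [MonoidalClosed C] [HasCoequalizers C]

/-- `M ⊗_A N` as a left `A`-module. -/
noncomputable def tensorMod (M N : Mod C A) : Mod C A :=
  letI B := (toBimod A).obj M ⊗ (toBimod A).obj N
  { X := B.X
    mod :=
      { smul := B.actLeft
        one_smul := B.one_actLeft
        mul_smul := B.left_assoc } }

/-- The bimodule of `M ⊗_A N` is the tensor product of the bimodules of `M` and `N`. -/
noncomputable def tensorModIso (M N : Mod C A) :
    (toBimod A).obj M ⊗ (toBimod A).obj N ≅ (toBimod A).obj (tensorMod A M N) :=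
  Bimod.isoOfIso (Iso.refl _)
    ((Category.comp_id _).trans (id_whiskerLeft_comp _).symm)
    (by
      let M' := (toBimod A).obj M
      let N' := (toBimod A).obj N
      refine (Category.comp_id _).trans (Eq.trans ?_ (id_whiskerRight_comp _).symm)
      have : (M' ⊗ N').actRight = (β_ (M' ⊗ N').X A).hom ≫ (M' ⊗ N').actLeft := by
        rw [← cancel_epi (bimodProj M' N' ▷ A),
          BraidedCategory.braiding_naturality_left_assoc]
        refine (bimodProj_actRight M' N').trans ?_
        refine Eq.trans ?_ (congrArg (fun t => (β_ (M.X ⊗ N.X) A).hom ≫ t)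
          (bimodProj_actLeft M' N').symm)
        exact balanced_right A (M := M.X) (N := N.X) _ (bimodProj_condition M' N')
      exact this)

/-- The regular bimodule `A` is the bimodule of the regular module `A`. -/
noncomputable def unitIso : 𝟙_ (Bimod (Mon.mk A) (Mon.mk A)) ≅ (toBimod A).obj (Mod.regular A) :=
  Bimod.isoOfIso (Iso.refl _) ((Category.comp_id _).trans (id_whiskerLeft_comp _).symm)
    ((Category.comp_id _).trans
      ((IsCommMonObj.mul_comm A).symm.trans (id_whiskerRight_comp _).symm))

/-- The relative tensor product of left modules, transported from bimodules along the fully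
faithful functor `toBimod A`. -/
noncomputable instance modMonoidalStruct : MonoidalCategoryStruct (Mod C A) where
  tensorObj M N := tensorMod A M N
  tensorUnit := Mod.regular A
  whiskerLeft M N N' f := (toBimod A).preimage
    ((tensorModIso A M N).inv ≫ (toBimod A).obj M ◁ (toBimod A).map f ≫ (tensorModIso A M N').hom)
  whiskerRight {M M'} f N := (toBimod A).preimage
    ((tensorModIso A M N).inv ≫ (toBimod A).map f ▷ (toBimod A).obj N ≫ (tensorModIso A M' N).hom)
  tensorHom {M M' N N'} f g := (toBimod A).preimage
    ((tensorModIso A M N).inv ≫ ((toBimod A).map f ⊗ₘ (toBimod A).map g) ≫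
      (tensorModIso A M' N').hom)
  associator M N P := (toBimod A).preimageIso
    (((tensorModIso A _ _).symm ≪≫ ((tensorModIso A _ _).symm ⊗ᵢ .refl _)) ≪≫
      α_ ((toBimod A).obj M) ((toBimod A).obj N) ((toBimod A).obj P) ≪≫
      ((.refl _ ⊗ᵢ tensorModIso A _ _) ≪≫ tensorModIso A _ _))
  leftUnitor M := (toBimod A).preimageIso
    (((tensorModIso A _ _).symm ≪≫ ((unitIso A).symm ⊗ᵢ .refl _)) ≪≫ λ_ ((toBimod A).obj M))
  rightUnitor M := (toBimod A).preimageIso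
    (((tensorModIso A _ _).symm ≪≫ (.refl _ ⊗ᵢ (unitIso A).symm)) ≪≫ ρ_ ((toBimod A).obj M))

/-- The data identifying the tensor product of modules with that of bimodules. -/
noncomputable def modInducing : Monoidal.InducingFunctorData (toBimod A) where
  μIso M N := tensorModIso A M N
  εIso := unitIso A
  whiskerLeft_eq _ _ _ _ := (toBimod A).map_preimage _
  whiskerRight_eq _ _ := (toBimod A).map_preimage _
  tensorHom_eq _ _ := (toBimod A).map_preimage _
  associator_eq _ _ _ := (toBimod A).map_preimage _
  leftUnitor_eq _ := (toBimod A).map_preimage _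
  rightUnitor_eq _ := (toBimod A).map_preimage _

noncomputable instance modMonoidal : MonoidalCategory (Mod C A) :=
  Monoidal.induced (toBimod A) (modInducing A)

noncomputable instance toBimodMonoidal : (toBimod A).Monoidal :=
  Monoidal.fromInducedMonoidal (toBimod A) (modInducing A)

/-- The projection `M ⊗ N ⟶ M ⊗_A N` for left modules. -/
noncomputable def modProj (M N : Mod C A) : M.X ⊗ N.X ⟶ (M ⊗ N).X :=
  coequalizer.π (((β_ M.X A).hom ≫ act A M.X) ▷ N.X) ((α_ M.X A N.X).hom ≫ M.X ◁ act A N.X)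

/-- `M ⊗_A N` is the coequalizer of the two actions of `A` on `M ⊗ N`. -/
lemma modProj_condition (M N : Mod C A) :
    ((β_ M.X A).hom ≫ act A M.X) ▷ N.X ≫ modProj A M N =
      ((α_ M.X A N.X).hom ≫ M.X ◁ act A N.X) ≫ modProj A M N :=
  coequalizer.condition _ _

/-- `M ⊗_A N` is the coequalizer of the two actions of `A` on `M ⊗ N`. -/
noncomputable def modProjIsColimit (M N : Mod C A) :
    IsColimit (Cofork.ofπ (modProj A M N) (modProj_condition A M N)) :=
  coequalizerIsCoequalizer _ _

/-- The action of `A` on `M ⊗_A N` is the one on `M`. -/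
lemma modProj_act (M N : Mod C A) :
    A ◁ modProj A M N ≫ act A (M ⊗ N).X = (α_ A M.X N.X).inv ≫ act A M.X ▷ N.X ≫ modProj A M N :=
  bimodProj_actLeft ((toBimod A).obj M) ((toBimod A).obj N)

/-- The lax monoidal forgetful functor: unit `η : 1 ⟶ A` and the projections `M ⊗ N ⟶ M ⊗_A N`. -/
noncomputable instance modForget : (Mod.forget (D := C) A).LaxMonoidal :=
  Functor.LaxMonoidal.copy
    (inferInstanceAs ((toBimod A ⋙ Bimod.forget (Mon.mk A)).LaxMonoidal))
    η[A] (fun M N => modProj A M N)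
    (Category.comp_id _).symm
    (by
      funext M N
      exact (Category.comp_id _).symm)

/-- A left module `M` is local if `l = l ∘ c_{M,A} ∘ c_{A,M}` for its action `l : A ⊗ M ⟶ M`. -/
def isLocal : ObjectProperty (Mod C A) := fun M =>
  act A M.X = (β_ A M.X).hom ≫ (β_ M.X A).hom ≫ act A M.X

instance isLocalMonoidal : (isLocal A).IsMonoidal where
  prop_unit := by
    change μ[A] = (β_ A A).hom ≫ (β_ A A).hom ≫ μ[A]
    simp only [IsCommMonObj.mul_comm]
  prop_tensor M N hM hN := by
    change act A (M ⊗ N).X = (β_ A (M ⊗ N).X).hom ≫ (β_ (M ⊗ N).X A).hom ≫ act A (M ⊗ N).X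
    have : Epi (A ◁ modProj A M N) := inferInstanceAs
      (Epi (A ◁ bimodProj ((toBimod A).obj M) ((toBimod A).obj N)))
    have hp : ((β_ M.X A).hom ≫ act A M.X) ▷ N.X ≫ modProj A M N =
        (α_ M.X A N.X).hom ≫ M.X ◁ act A N.X ≫ modProj A M N := by
      rw [modProj_condition, Category.assoc]
    rw [← cancel_epi (A ◁ modProj A M N), BraidedCategory.braiding_naturality_right_assoc,
      BraidedCategory.braiding_naturality_left_assoc, modProj_act, ← balanced_right A _ hp,
      BraidedCategory.braiding_tensor_right_hom]
    simp only [Category.assoc, Iso.inv_hom_id_assoc]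
    rw [← whiskerLeft_comp_assoc M.X (β_ A N.X).hom, ← hN, ← hp, ← comp_whiskerRight_assoc, ← hM]

/-- The monoidal category of local `A`-modules, a full monoidal subcategory of `A`-modules. -/
abbrev LocMod : Type max u v := (isLocal A).FullSubcategory

/-- The forgetful functor from local `A`-modules to `C`. -/
@[simps]
def LocMod.forget : LocMod A ⥤ C where
  obj M := M.obj.X
  map f := f.hom.hom

/-- The lax monoidal structure of the forgetful functor: its unit is `η : 1 ⟶ A`, and its
multiplication consists of the projections `M ⊗ N ⟶ M ⊗_A N`. -/
noncomputable instance locForget : (LocMod.forget A).LaxMonoidal :=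
  Functor.LaxMonoidal.copy
    (inferInstanceAs (((isLocal A).ι ⋙ Mod.forget (D := C) A).LaxMonoidal))
    η[A] (fun M N => modProj A M.obj N.obj)
    (Category.comp_id _).symm
    (by
      funext M N
      exact (Category.comp_id _).symm)

end Br

section Dual
variable {C : Type u} [Category.{v} C] [MonoidalCategory C] [MonoidalClosed C]

open scoped MonObj

/-- For a right action `r : M ⊗ A ⟶ M`, the left action of `A` on the left internal hom `M ⊸ N`:
the transpose `A ⟶ M ⊸ M` of `r`, followed by internal composition. -/
def ihomAct {A M : C} (r : M ⊗ A ⟶ M) (N : C) : A ⊗ (ihom M).obj N ⟶ (ihom M).obj N :=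
  MonoidalClosed.curry r ▷ (ihom M).obj N ≫ MonoidalClosed.comp M M N

variable (A : C) [MonObj A] (K : C)

lemma one_curry_mul : η[A] ≫ MonoidalClosed.curry μ[A] = MonoidalClosed.id A := by
  rw [← MonoidalClosed.curry_natural_left, MonObj.mul_one]; rfl

lemma mul_curry_mul : μ[A] ≫ MonoidalClosed.curry μ[A] =
    MonoidalClosed.curry μ[A] ▷ A ≫ (ihom A).obj A ◁ MonoidalClosed.curry μ[A] ≫
      MonoidalClosed.comp A A A := by
  have h : A ◁ MonoidalClosed.curry μ[A] ≫ (ihom.ev A).app A = μ[A] := by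
    rw [← MonoidalClosed.uncurry_eq, MonoidalClosed.uncurry_curry]
  rw [MonoidalClosed.comp, ← MonoidalClosed.curry_natural_left,
    ← MonoidalClosed.curry_natural_left, ← MonoidalClosed.curry_natural_left,
    MonoidalClosed.compTranspose]
  congr 1
  rw [associator_inv_naturality_right_assoc, whisker_exchange_assoc]
  simp only [Functor.id_obj]
  rw [h,
    associator_inv_naturality_middle_assoc, ← comp_whiskerRight_assoc, h, MonObj.mul_assoc_flip]

/-- The left `A`-module `D'(A) = A ⊸ K`, with the action induced by the multiplication of `A`. -/
def dualModule : Mod C A where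
  X := (ihom A).obj K
  mod :=
    { smul := ihomAct μ[A] K
      one_smul := by
        change η[A] ▷ _ ≫ MonoidalClosed.curry μ[A] ▷ _ ≫ MonoidalClosed.comp A A K = (λ_ _).hom
        rw [← comp_whiskerRight_assoc, one_curry_mul, ← cancel_epi (λ_ _).inv,
          MonoidalClosed.id_comp, Iso.inv_hom_id]
      mul_smul := by
        change μ[A] ▷ _ ≫ MonoidalClosed.curry μ[A] ▷ _ ≫ MonoidalClosed.comp A A K =
          (α_ A A _).hom ≫ A ◁ (MonoidalClosed.curry μ[A] ▷ _ ≫ MonoidalClosed.comp A A K) ≫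
            MonoidalClosed.curry μ[A] ▷ _ ≫ MonoidalClosed.comp A A K
        have := MonoidalClosed.assoc A A A K
        rw [← cancel_epi (α_ _ _ _).hom, Iso.hom_inv_id_assoc] at this
        rw [← comp_whiskerRight_assoc, mul_curry_mul]
        simp only [comp_whiskerRight, Category.assoc, this, whiskerLeft_comp]
        rw [whisker_exchange_assoc, whisker_exchange_assoc]
        simp }

/-- The morphism `D'(η) : D'(A) ⟶ D'(1) ≅ K`, evaluation at the unit of `A`. -/
def dualUnit : (ihom A).obj K ⟶ K :=
  (MonoidalClosed.pre η[A]).app K ≫ (λ_ _).inv ≫ (ihom.ev (𝟙_ C)).app K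

end Dual

section GVdefs

variable (C : Type u) [Category.{v} C] [MonoidalCategory C]

/-- Right closed monoidal categories: a chosen right adjoint `? ⟜ X` of each functor `? ⊗ X`.
(Left closedness, i.e. right adjoints `X ⊸ ?` of the functors `X ⊗ ?`, is `MonoidalClosed`.) -/
class MonoidalRightClosed where
  /-- The right internal hom `? ⟜ X`. -/
  rightHom (X : C) : C ⥤ C
  /-- The tensor-hom adjunction. -/
  adj (X : C) : tensorRight X ⊣ rightHom X

variable {C}

/-- The functor `Y ↦ Hom(- ⊗ Y, K)` from `Cᵒᵖ` to presheaves on `C`. -/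
def pairings (K : C) : Cᵒᵖ ⥤ Cᵒᵖ ⥤ Type v where
  obj Y := (tensorRight Y.unop).op ⋙ yoneda.obj K
  map f := Functor.whiskerRight (NatTrans.op ((tensoringRight C).map f.unop)) (yoneda.obj K)

/-- `K` is dualizing if each functor `Hom(- ⊗ Y, K)` is represented by an object `D Y` and the
resulting contravariant functor `D` is an antiequivalence. -/
def IsDualizing (K : C) : Prop :=
  ∃ D : Cᵒᵖ ⥤ C, Nonempty (D ⋙ yoneda ≅ pairings K) ∧ D.IsEquivalence

/-- A Grothendieck-Verdier category: a closed monoidal category with a dualizing object. Closedness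
follows from the existence of a dualizing object (see `GVCategory.ofIsDualizing`); the class fixes a
choice of internal homs. -/
class GVCategory (C : Type u) [Category.{v} C] [MonoidalCategory C] extends
    MonoidalClosed C, MonoidalRightClosed C where
  /-- The dualizing object. -/
  K : C
  isDualizing : IsDualizing K

/-- The dualizing object `K` of a Grothendieck-Verdier category. -/
def dualizingObj (C : Type u) [Category.{v} C] [MonoidalCategory C] [GVCategory C] : C := GVCategory.K

section Closedness
variable {K : C} {D : Cᵒᵖ ⥤ C}

/-- The bijection `Hom(X, D Y) ≃ Hom(X ⊗ Y, K)`. -/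
def pairEquiv (e : D ⋙ yoneda ≅ pairings K) (X Y : C) :
    (X ⟶ D.obj (.op Y)) ≃ (X ⊗ Y ⟶ K) :=
  ((e.app (.op Y)).app (.op X)).toEquiv

lemma pairEquiv_left (e : D ⋙ yoneda ≅ pairings K) {X X' Y : C} (f : X' ⟶ X)
    (g : X ⟶ D.obj (.op Y)) : pairEquiv e X' Y (f ≫ g) = f ▷ Y ≫ pairEquiv e X Y g :=
  NatTrans.naturality_apply (e.hom.app (.op Y)) f.op g

lemma pairEquiv_right (e : D ⋙ yoneda ≅ pairings K) {X Y Y' : C} (f : Y' ⟶ Y)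
    (g : X ⟶ D.obj (.op Y)) : pairEquiv e X Y' (g ≫ D.map f.op) = X ◁ f ≫ pairEquiv e X Y g :=
  congrArg (fun t => t g) (congrArg (fun t => t.app (.op X)) (e.hom.naturality f.op))

/-- A dualizing object yields left internal homs `X ⊸ Z`. -/
lemma tensorLeft_isLeftAdjoint (e : D ⋙ yoneda ≅ pairings K) [D.IsEquivalence] (X : C) :
    (tensorLeft X).IsLeftAdjoint := by
  let W (Z : C) : C := (D.objPreimage (D.obj (.op Z) ⊗ X)).unop
  let w (Z : C) : D.obj (.op (W Z)) ≅ D.obj (.op Z) ⊗ X := D.objObjPreimageIso _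
  let E (Y Z : C) : (X ⊗ Y ⟶ Z) ≃ (Y ⟶ W Z) :=
    ((Quiver.Hom.opEquiv.trans (Functor.FullyFaithful.ofFullyFaithful D).homEquiv).trans
      ((pairEquiv e (D.obj (.op Z)) (X ⊗ Y)).trans ((α_ (D.obj (.op Z)) X Y).symm.homFromEquiv.trans
        (pairEquiv e (D.obj (.op Z) ⊗ X) Y).symm))).trans ((w Z).homFromEquiv.symm.trans
        ((Functor.FullyFaithful.ofFullyFaithful D).homEquiv.symm.trans Quiver.Hom.opEquiv.symm))
  have hE (Y Z : C) (g : X ⊗ Y ⟶ Z) : pairEquiv e _ _ ((w Z).inv ≫ D.map (E Y Z g).op) =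
      (α_ _ _ _).hom ≫ pairEquiv e _ _ (D.map g.op) := by
    simp only [E, Equiv.trans_apply]
    change pairEquiv e _ _ ((w Z).inv ≫ D.map
      ((Functor.FullyFaithful.ofFullyFaithful D).preimage _)) = _
    rw [Functor.FullyFaithful.map_preimage]
    simp
    rfl
  refine (Adjunction.adjunctionOfEquivRight (F := tensorLeft X) (G_obj := W) E ?_).isLeftAdjoint
  intro Y' Y Z f g
  apply Quiver.Hom.op_inj
  apply D.map_injective
  rw [← cancel_epi (w Z).inv]
  apply (pairEquiv e _ _).injective
  refine (hE _ _ _).trans ?_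
  rw [op_comp, op_comp, D.map_comp, D.map_comp, ← Category.assoc (w Z).inv]
  refine Eq.trans ?_ (pairEquiv_right e f _).symm
  rw [hE]
  refine (congrArg _ (pairEquiv_right e (X ◁ f) _)).trans ?_
  simp

/-- A dualizing object yields right internal homs `Z ⟜ X`. -/
lemma tensorRight_isLeftAdjoint (e : D ⋙ yoneda ≅ pairings K) [D.IsEquivalence] (X : C) :
    (tensorRight X).IsLeftAdjoint := by
  let V (Z : C) : C := (D.objPreimage Z).unop
  let w (Z : C) : D.obj (.op (V Z)) ≅ Z := D.objObjPreimageIso _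
  let E (Y Z : C) : (Y ⊗ X ⟶ Z) ≃ (Y ⟶ D.obj (.op (X ⊗ V Z))) :=
    (w Z).symm.homToEquiv.trans ((pairEquiv e (Y ⊗ X) (V Z)).trans
      ((α_ Y X (V Z)).homFromEquiv.trans (pairEquiv e Y (X ⊗ V Z)).symm))
  have hE (Y Z : C) (g : Y ⊗ X ⟶ Z) : pairEquiv e _ _ (E Y Z g) =
      (α_ _ _ _).inv ≫ pairEquiv e _ _ (g ≫ (w Z).inv) := by
    simp [E]
  refine (Adjunction.adjunctionOfEquivRight (F := tensorRight X) E ?_).isLeftAdjoint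
  intro Y' Y Z f g
  apply (pairEquiv e _ _).injective
  refine (hE _ _ _).trans ?_
  refine Eq.trans ?_ (pairEquiv_left e f (E Y Z g)).symm
  rw [hE, Category.assoc]
  refine (congrArg _ (pairEquiv_left e (f ▷ X) _)).trans ?_
  simp

/-- A monoidal category with a dualizing object is closed, hence a Grothendieck-Verdier category. -/
@[reducible]
noncomputable def GVCategory.ofIsDualizing (hK : IsDualizing K) : GVCategory C where
  closed X :=
    { rightAdj :=
        haveI := hK.choose_spec.2
        haveI := tensorLeft_isLeftAdjoint hK.choose_spec.1.some X
        (tensorLeft X).rightAdjoint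
      adj :=
        haveI := hK.choose_spec.2
        haveI := tensorLeft_isLeftAdjoint hK.choose_spec.1.some X
        Adjunction.ofIsLeftAdjoint _ }
  rightHom X :=
    haveI := hK.choose_spec.2
    haveI := tensorRight_isLeftAdjoint hK.choose_spec.1.some X
    (tensorRight X).rightAdjoint
  adj X :=
    haveI := hK.choose_spec.2
    haveI := tensorRight_isLeftAdjoint hK.choose_spec.1.some X
    Adjunction.ofIsLeftAdjoint _
  K := K
  isDualizing := hK

end Closedness

section Comparators

open Functor.LaxMonoidal

variable {D : Type*} [Category* D] [MonoidalCategory D] (F : C ⥤ D) [F.LaxMonoidal]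

/-- The left comparator `τˡ : F (X ⊸ Y) ⟶ F X ⊸ F Y`, the transpose of
`F X ⊗ F (X ⊸ Y) ⟶ F (X ⊗ (X ⊸ Y)) ⟶ F Y`. -/
def leftComparator [MonoidalClosed C] [MonoidalClosed D] (X Y : C) :
    F.obj ((ihom X).obj Y) ⟶ (ihom (F.obj X)).obj (F.obj Y) :=
  (ihom.coev (F.obj X)).app (F.obj ((ihom X).obj Y)) ≫
    (ihom (F.obj X)).map (μ F X ((ihom X).obj Y) ≫ F.map ((ihom.ev X).app Y))

/-- The right comparator `τʳ : F (Y ⟜ X) ⟶ F Y ⟜ F X`, the transpose of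
`F (Y ⟜ X) ⊗ F X ⟶ F ((Y ⟜ X) ⊗ X) ⟶ F Y`. -/
def rightComparator [MonoidalRightClosed C] [MonoidalRightClosed D] (Y X : C) :
    F.obj ((MonoidalRightClosed.rightHom X).obj Y) ⟶ (MonoidalRightClosed.rightHom (F.obj X)).obj (F.obj Y) :=
  (MonoidalRightClosed.adj (F.obj X)).unit.app (F.obj ((MonoidalRightClosed.rightHom X).obj Y)) ≫
    (MonoidalRightClosed.rightHom (F.obj X)).map (μ F ((MonoidalRightClosed.rightHom X).obj Y) X ≫ F.map ((MonoidalRightClosed.adj X).counit.app Y))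

variable [GVCategory C] [GVCategory D] (υ : F.obj (dualizingObj C) ⟶ dualizingObj D)

/-- The left duality transformation `ξˡ : F (X ⊸ K) ⟶ F X ⊸ K` of a form `υ : F K ⟶ K`. -/
def leftDualityTransformation (X : C) :
    F.obj ((ihom X).obj (dualizingObj C)) ⟶ (ihom (F.obj X)).obj (dualizingObj D) :=
  leftComparator F X (dualizingObj C) ≫ (ihom (F.obj X)).map υ

/-- The right duality transformation `ξʳ : F (K ⟜ X) ⟶ K ⟜ F X` of a form `υ : F K ⟶ K`. -/
def rightDualityTransformation (X : C) :
    F.obj ((MonoidalRightClosed.rightHom X).obj (dualizingObj C)) ⟶ (MonoidalRightClosed.rightHom (F.obj X)).obj (dualizingObj D) :=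
  rightComparator F (dualizingObj C) X ≫ (MonoidalRightClosed.rightHom (F.obj X)).map υ

/-- A form `υ : F K ⟶ K` is Frobenius if its duality transformations are invertible. A GV-functor is
a lax monoidal functor equipped with a Frobenius form. -/
structure IsFrobeniusForm : Prop where
  isIso_left (X : C) : IsIso (leftDualityTransformation F υ X)
  isIso_right (X : C) : IsIso (rightDualityTransformation F υ X)

/-- The lax monoidal functor `F` with the form `υ` is a braided GV-functor: `υ` is Frobenius, and
`F` is braided as a lax monoidal functor. -/
structure IsBraidedGVFunctor [BraidedCategory C] [BraidedCategory D] : Prop where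
  frobenius : IsFrobeniusForm F υ
  braided (X Y : C) : μ F X Y ≫ F.map (β_ X Y).hom = (β_ (F.obj X) (F.obj Y)).hom ≫ μ F Y X

end Comparators

end GVdefs

end GVCat

open GVCat

/-! Everything is expressed through perfect pairings `X ⊗ Y ⟶ K`, those universal in both variables.
In a braided category, `K` is dualizing as soon as every object is the second factor of such a
pairing (`isDualizing_of_isPerfect`), and a form is Frobenius as soon as, for each object, one
universal pairing on either side is sent to a universal one (`isFrobeniusForm_of_isPerfect`). The
module `D'(A)` is coinduced: composing with `D'(η)` identifies module maps into it with maps to `K`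
in `C` (`bijective_comp_dualUnit`). Hence maps `M ⊗_A N ⟶ D'(A)` are the same as `A`-balanced maps
`M ⊗ N ⟶ K`. Given a local module `N`, take a perfect pairing `p : X ⊗ N ⟶ K` in `C` and transpose
the action of `A` from `N` to `X`. Then `p` is balanced by construction. The new module is local
because locality of `D'(A)` makes every map `A ⊗ X ⟶ K` blind to the monodromy
(`monodromy_comp_of_isLocal`). So `p` lifts to a pairing with values in `D'(A)`. The lift is again
perfect, since maps produced by the universal property of `p` are automatically linear
(`isPerfect_of_locPairing`). Its image under the forgetful functor and `D'(η)` is `p` itself, which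
gives the Frobenius property. The braiding of `C` descends to `⊗_A` by locality; its axioms are
inherited because the forgetful functor is faithful with epimorphic tensorators. -/

namespace GVCat

/-! ### Perfect pairings and dualizing objects -/

section Pairings
variable {C : Type u} [Category.{v} C] [MonoidalCategory C] {K : C}

/-- The pairing `p : X ⊗ Y ⟶ K` exhibits `X` as representing `Hom(- ⊗ Y, K)`. -/
def RightUniversal {X Y : C} (p : X ⊗ Y ⟶ K) : Prop :=
  ∀ Z : C, Function.Bijective fun f : Z ⟶ X => f ▷ Y ≫ p

/-- The pairing `p : X ⊗ Y ⟶ K` exhibits `Y` as representing `Hom(X ⊗ -, K)`. -/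
def LeftUniversal {X Y : C} (p : X ⊗ Y ⟶ K) : Prop :=
  ∀ Z : C, Function.Bijective fun g : Z ⟶ Y => X ◁ g ≫ p

/-- A pairing is perfect if it is universal in both variables. -/
structure IsPerfect {X Y : C} (p : X ⊗ Y ⟶ K) : Prop where
  right : RightUniversal p
  left : LeftUniversal p

lemma RightUniversal.hom_ext {X Y Z : C} {p : X ⊗ Y ⟶ K} (hp : RightUniversal p) {f g : Z ⟶ X}
    (h : f ▷ Y ≫ p = g ▷ Y ≫ p) : f = g :=
  (hp Z).1 h

lemma LeftUniversal.hom_ext {X Y Z : C} {p : X ⊗ Y ⟶ K} (hp : LeftUniversal p) {f g : Z ⟶ Y}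
    (h : X ◁ f ≫ p = X ◁ g ≫ p) : f = g :=
  (hp Z).1 h

lemma RightUniversal.exists_iso {X X' Y : C} {p : X ⊗ Y ⟶ K} {p' : X' ⊗ Y ⟶ K}
    (hp : RightUniversal p) (hp' : RightUniversal p') : ∃ e : X ≅ X', e.hom ▷ Y ≫ p' = p := by
  obtain ⟨f, hf⟩ := (hp' X).2 p
  obtain ⟨g, hg⟩ := (hp X').2 p'
  dsimp only at hf hg
  exact ⟨⟨f, g, hp.hom_ext (by simp [hg, hf]), hp'.hom_ext (by simp [hg, hf])⟩, hf⟩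

lemma LeftUniversal.exists_iso {X Y Y' : C} {p : X ⊗ Y ⟶ K} {p' : X ⊗ Y' ⟶ K}
    (hp : LeftUniversal p) (hp' : LeftUniversal p') : ∃ e : Y ≅ Y', X ◁ e.hom ≫ p' = p := by
  obtain ⟨f, hf⟩ := (hp' Y).2 p
  obtain ⟨g, hg⟩ := (hp Y').2 p'
  dsimp only at hf hg
  exact ⟨⟨f, g, hp.hom_ext (by simp [hg, hf]), hp'.hom_ext (by simp [hg, hf])⟩, hf⟩

lemma RightUniversal.of_iso {X X' Y : C} {p : X ⊗ Y ⟶ K} (hp : RightUniversal p) (e : X' ≅ X) :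
    RightUniversal (e.hom ▷ Y ≫ p) := fun Z => by
  simpa only [Function.comp_def, Iso.homToEquiv, Equiv.coe_fn_mk, comp_whiskerRight,
    Category.assoc] using (hp Z).comp e.homToEquiv.bijective

lemma LeftUniversal.of_iso {X Y Y' : C} {p : X ⊗ Y ⟶ K} (hp : LeftUniversal p) (e : Y' ≅ Y) :
    LeftUniversal (X ◁ e.hom ≫ p) := fun Z => by
  simpa only [Function.comp_def, Iso.homToEquiv, Equiv.coe_fn_mk, whiskerLeft_comp,
    Category.assoc] using (hp Z).comp e.homToEquiv.bijective

lemma isIso_of_rightUniversal {X X' Y : C} {p : X ⊗ Y ⟶ K} {p' : X' ⊗ Y ⟶ K}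
    (hp : RightUniversal p) (hp' : RightUniversal p') {f : X ⟶ X'} (hf : f ▷ Y ≫ p' = p) :
    IsIso f := by
  obtain ⟨e, he⟩ := hp.exists_iso hp'
  rw [hp'.hom_ext (hf.trans he.symm)]
  infer_instance

lemma isIso_of_leftUniversal {X Y Y' : C} {p : X ⊗ Y ⟶ K} {p' : X ⊗ Y' ⟶ K}
    (hp : LeftUniversal p) (hp' : LeftUniversal p') {f : Y ⟶ Y'} (hf : X ◁ f ≫ p' = p) :
    IsIso f := by
  obtain ⟨e, he⟩ := hp.exists_iso hp'
  rw [hp'.hom_ext (hf.trans he.symm)]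
  infer_instance

lemma rightUniversal_counit [MonoidalRightClosed C] (X K : C) :
    RightUniversal (((MonoidalRightClosed.adj X).counit.app K :
      (MonoidalRightClosed.rightHom X).obj K ⊗ X ⟶ K)) := fun Z =>
  ((MonoidalRightClosed.adj X).homEquiv Z K).symm.bijective

lemma leftUniversal_ev [MonoidalClosed C] (X K : C) :
    LeftUniversal (((ihom.ev X).app K : X ⊗ (ihom X).obj K ⟶ K)) := fun Z =>
  ((ihom.adjunction X).homEquiv Z K).symm.bijective

/-- In the presence of a dualizing object, every object is the second factor of a perfect pairing. -/
lemma IsDualizing.exists_isPerfect (hK : IsDualizing K) (Y : C) :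
    ∃ (X : C) (p : X ⊗ Y ⟶ K), IsPerfect p := by
  obtain ⟨D, ⟨e⟩, hD⟩ := hK
  refine ⟨D.obj (.op Y), pairEquiv e _ _ (𝟙 _), fun Z => ?_, fun Z => ?_⟩
  · convert (pairEquiv e Z Y).bijective using 2 with f
    rw [← pairEquiv_left, Category.comp_id]
  -- Universality in the second variable is full faithfulness of `D`.
  · convert ((Quiver.Hom.opEquiv.trans (Functor.FullyFaithful.ofFullyFaithful D).homEquiv).trans
      (pairEquiv e _ Z)).bijective using 2 with g
    rw [← pairEquiv_right, Category.id_comp]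
    rfl

/-- Precomposing with the braiding exchanges the two universal properties. -/
lemma IsPerfect.braid [BraidedCategory C] {X Y : C} {p : X ⊗ Y ⟶ K} (hp : IsPerfect p) :
    IsPerfect ((β_ Y X).hom ≫ p) := by
  constructor
  · intro Z
    convert (β_ Z X).homFromEquiv.symm.bijective.comp (hp.left Z) using 2 with g
    simp [Iso.homFromEquiv]
  · intro Z
    convert (β_ Y Z).homFromEquiv.symm.bijective.comp (hp.right Z) using 2 with g
    simp [Iso.homFromEquiv]

/-- Right universality makes the first factors into a functor representing the pairings, and left
universality makes this functor fully faithful. The braiding gives essential surjectivity: it turns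
the pairing of `D X` with `X` into one of `X` with `D X`, so `X` is a dual of `D X`. -/
lemma isDualizing_of_isPerfect [BraidedCategory C]
    (h : ∀ Y : C, ∃ (X : C) (p : X ⊗ Y ⟶ K), IsPerfect p) : IsDualizing K := by
  choose D p hp using h
  let E (X Y : C) : (X ⟶ D Y) ≃ (X ⊗ Y ⟶ K) := .ofBijective _ ((hp Y).right X)
  have hE (X Y : C) (q : X ⊗ Y ⟶ K) : (E X Y).symm q ▷ Y ≫ p Y = q := (E X Y).apply_symm_apply q
  let F : Cᵒᵖ ⥤ C :=
    { obj Y := D Y.unop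
      map {Y Y'} f := (E _ _).symm (D Y.unop ◁ f.unop ≫ p Y.unop)
      map_id Y := (hp _).right.hom_ext (by rw [hE]; simp)
      map_comp {X Y Z} f g := (hp _).right.hom_ext (by
        rw [hE, comp_whiskerRight, Category.assoc, hE, ← whisker_exchange_assoc, hE]
        simp) }
  have hF {Y Y' : C} (f : Y' ⟶ Y) : F.map f.op ▷ Y' ≫ p Y' = D Y ◁ f ≫ p Y := hE _ _ _
  refine ⟨F, ⟨NatIso.ofComponents (fun Y => NatIso.ofComponents
    (fun X => (E X.unop Y.unop).toIso) ?_) ?_⟩, ?_⟩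
  · intro X X' f
    ext g
    exact (comp_whiskerRight_assoc ..).trans rfl
  · intro Y Y' f
    ext X g
    change (g ≫ F.map f) ▷ _ ≫ p _ = _ ◁ f.unop ≫ g ▷ _ ≫ p _
    rw [comp_whiskerRight_assoc, whisker_exchange_assoc]
    exact congrArg _ (hF f.unop)
  · have : F.Faithful := ⟨fun {Y Y'} f g hfg => Quiver.Hom.unop_inj ((hp _).left.hom_ext
      ((hF f.unop).symm.trans ((congrArg (fun t => t ▷ _ ≫ p _) hfg).trans (hF g.unop))))⟩
    have : F.Full := ⟨fun {Y Y'} g => by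
      obtain ⟨f, hf⟩ := ((hp Y.unop).left Y'.unop).2 (g ▷ _ ≫ p _)
      exact ⟨f.op, (hp _).right.hom_ext ((hF f).trans hf)⟩⟩
    have : F.EssSurj := ⟨fun X => by
      obtain ⟨e, -⟩ := (hp (D X)).right.exists_iso (hp X).braid.right
      exact ⟨.op (D X), ⟨e⟩⟩⟩
    exact { }

end Pairings

/-! ### Lax monoidal functors: lifting braidings and transporting pairings -/

section Lax
open Functor.LaxMonoidal

variable {C D : Type*} [Category* C] [Category* D] [MonoidalCategory C] [MonoidalCategory D]
  (F : C ⥤ D) [F.LaxMonoidal]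

/-- Lift a braiding along a faithful lax monoidal functor whose tensorators are epimorphisms,
universally with respect to tensoring with objects in the image. -/
@[reducible]
def braidedOfFaithfulLax [F.Faithful] [BraidedCategory D]
    [∀ X Y, Epi (μ F X Y)] [∀ X Y Z, Epi (μ F X Y ▷ F.obj Z)] [∀ X Y Z, Epi (F.obj Z ◁ μ F X Y)]
    (b : ∀ X Y : C, X ⊗ Y ≅ Y ⊗ X)
    (w : ∀ X Y, μ F _ _ ≫ F.map (b X Y).hom = (β_ _ _).hom ≫ μ F _ _) :
    BraidedCategory C where
  braiding := b
  braiding_naturality_left f Z := by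
    apply F.map_injective
    refine (cancel_epi (μ F _ _)).1 ?_
    rw [Functor.map_comp, ← μ_natural_left_assoc, w, Functor.map_comp,
      reassoc_of% w, BraidedCategory.braiding_naturality_left_assoc, μ_natural_right]
  braiding_naturality_right Z _ _ f := by
    apply F.map_injective
    refine (cancel_epi (μ F _ _)).1 ?_
    rw [Functor.map_comp, ← μ_natural_right_assoc, w, Functor.map_comp,
      reassoc_of% w, BraidedCategory.braiding_naturality_right_assoc, μ_natural_left]
  hexagon_forward X Y Z := by
    -- Cancelling the tensorators, one of them whiskered, reduces the hexagon to the one in `D`.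
    apply F.map_injective
    refine (cancel_epi (μ F _ _)).1 ?_
    refine (cancel_epi (μ F _ _ ▷ _)).1 ?_
    rw [Functor.map_comp, Functor.map_comp, Functor.map_comp, Functor.map_comp, ←
      μ_natural_left_assoc, ← comp_whiskerRight_assoc, w,
      comp_whiskerRight_assoc, Functor.LaxMonoidal.associativity_assoc,
      Functor.LaxMonoidal.associativity_assoc, ← μ_natural_right, ←
      whiskerLeft_comp_assoc, w, whiskerLeft_comp_assoc,
      reassoc_of% w, BraidedCategory.braiding_naturality_right_assoc,
      Functor.LaxMonoidal.associativity, BraidedCategory.hexagon_forward_assoc]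
  hexagon_reverse X Y Z := by
    apply F.map_injective
    refine (cancel_epi (μ F _ _)).1 ?_
    refine (cancel_epi (_ ◁ μ F _ _)).1 ?_
    rw [Functor.map_comp, Functor.map_comp, Functor.map_comp, Functor.map_comp, ←
      μ_natural_right_assoc, ← whiskerLeft_comp_assoc, w,
      whiskerLeft_comp_assoc, Functor.LaxMonoidal.associativity_inv_assoc,
      Functor.LaxMonoidal.associativity_inv_assoc, ← μ_natural_left,
      ← comp_whiskerRight_assoc, w, comp_whiskerRight_assoc, reassoc_of% w,
      BraidedCategory.braiding_naturality_left_assoc, Functor.LaxMonoidal.associativity_inv,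
      BraidedCategory.hexagon_reverse_assoc]

/-- The pairing `F X ⊗ F Y ⟶ k` induced by a pairing `X ⊗ Y ⟶ K` and a form `υ : F K ⟶ k`. -/
def mapPairing {K : C} {k : D} (υ : F.obj K ⟶ k) {X Y : C} (p : X ⊗ Y ⟶ K) :
    F.obj X ⊗ F.obj Y ⟶ k :=
  μ F X Y ≫ F.map p ≫ υ

variable {K : C} {k : D} (υ : F.obj K ⟶ k)

lemma mapPairing_whiskerRight {X X' Y : C} (f : X ⟶ X') (p : X' ⊗ Y ⟶ K) :
    mapPairing F υ (f ▷ Y ≫ p) = F.map f ▷ F.obj Y ≫ mapPairing F υ p := by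
  simp [mapPairing]

lemma mapPairing_whiskerLeft {X Y Y' : C} (f : Y ⟶ Y') (p : X ⊗ Y' ⟶ K) :
    mapPairing F υ (X ◁ f ≫ p) = F.obj X ◁ F.map f ≫ mapPairing F υ p := by
  simp [mapPairing]

/-- Right universal pairings with the same second factor differ by an isomorphism, which `F`
preserves. Thus universality of the image need only be tested on one of them. -/
lemma RightUniversal.mapPairing {X X' Y : C} {p : X ⊗ Y ⟶ K} {p' : X' ⊗ Y ⟶ K}
    (hp : RightUniversal p) (hp' : RightUniversal p') (h : RightUniversal (mapPairing F υ p)) :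
    RightUniversal (GVCat.mapPairing F υ p') := by
  obtain ⟨e, he⟩ := hp'.exists_iso hp
  rw [← he, mapPairing_whiskerRight]
  exact h.of_iso (F.mapIso e)

lemma LeftUniversal.mapPairing {X Y Y' : C} {p : X ⊗ Y ⟶ K} {p' : X ⊗ Y' ⟶ K}
    (hp : LeftUniversal p) (hp' : LeftUniversal p') (h : LeftUniversal (mapPairing F υ p)) :
    LeftUniversal (GVCat.mapPairing F υ p') := by
  obtain ⟨e, he⟩ := hp'.exists_iso hp
  rw [← he, mapPairing_whiskerLeft]
  exact h.of_iso (F.mapIso e)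

end Lax

/-! ### A criterion for Frobenius forms -/

section Frobenius

variable {C : Type u} [Category.{v} C] [MonoidalCategory C] [GVCategory C]
  {D : Type*} [Category* D] [MonoidalCategory D] [GVCategory D] (F : C ⥤ D) [F.LaxMonoidal]
  (υ : F.obj (dualizingObj C) ⟶ dualizingObj D)

/-- This exhibits the duality transformation as the comparison from the image of one evaluation
pairing to another evaluation pairing, so it is invertible once that image is universal. -/
lemma leftDualityTransformation_ev (X : C) :
    F.obj X ◁ leftDualityTransformation F υ X ≫ (ihom.ev (F.obj X)).app (dualizingObj D) =
      mapPairing F υ ((ihom.ev X).app (dualizingObj C)) := by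
  simp [leftDualityTransformation, leftComparator, mapPairing]

lemma rightDualityTransformation_counit (X : C) :
    rightDualityTransformation F υ X ▷ F.obj X ≫
        (MonoidalRightClosed.adj (F.obj X)).counit.app (dualizingObj D) =
      mapPairing F υ ((MonoidalRightClosed.adj X).counit.app (dualizingObj C)) := by
  have h := ((MonoidalRightClosed.adj (F.obj X)).homEquiv _ _).symm_apply_apply
    (mapPairing F υ ((MonoidalRightClosed.adj X).counit.app (dualizingObj C)))
  rw [Adjunction.homEquiv_unit, Adjunction.homEquiv_counit] at h
  refine Eq.trans ?_ h
  simp only [rightDualityTransformation, rightComparator, mapPairing, Functor.map_comp,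
    Category.assoc]
  simp

/-- A form is Frobenius if it turns sufficiently many universal pairings into universal ones. -/
lemma isFrobeniusForm_of_isPerfect
    (hr : ∀ Y : C, ∃ (X : C) (p : X ⊗ Y ⟶ dualizingObj C),
      RightUniversal p ∧ RightUniversal (mapPairing F υ p))
    (hl : ∀ X : C, ∃ (Y : C) (p : X ⊗ Y ⟶ dualizingObj C),
      LeftUniversal p ∧ LeftUniversal (mapPairing F υ p)) : IsFrobeniusForm F υ where
  isIso_left X := by
    obtain ⟨Y, p, hp, hp'⟩ := hl X
    exact isIso_of_leftUniversal (hp.mapPairing F υ (leftUniversal_ev X _) hp')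
      (leftUniversal_ev _ _) (leftDualityTransformation_ev F υ X)
  isIso_right X := by
    obtain ⟨Y, p, hp, hp'⟩ := hr X
    exact isIso_of_rightUniversal (hp.mapPairing F υ (rightUniversal_counit X _) hp')
      (rightUniversal_counit _ _) (rightDualityTransformation_counit F υ X)

end Frobenius

open scoped MonObj

/-! ### `D'(A)` as a coinduced module -/

section Coinduced
variable {C : Type u} [Category.{v} C] [MonoidalCategory C] [MonoidalClosed C]
  (A : C) [MonObj A] (K : C)

/-- In elements: `(a · φ)(b) = φ(ba)`. -/
lemma ev_ihomAct_mul :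
    A ◁ ihomAct μ[A] K ≫ (ihom.ev A).app K =
      (α_ A A ((ihom A).obj K)).inv ≫ μ[A] ▷ (ihom A).obj K ≫ (ihom.ev A).app K := by
  rw [ihomAct, MonoidalClosed.comp, whiskerLeft_comp, Category.assoc,
    MonoidalClosed.whiskerLeft_curry_ihom_ev_app, MonoidalClosed.compTranspose,
    associator_inv_naturality_middle_assoc, ← comp_whiskerRight_assoc,
    MonoidalClosed.whiskerLeft_curry_ihom_ev_app]

lemma dualUnit_eq :
    dualUnit A K = (λ_ ((ihom A).obj K)).inv ≫ η[A] ▷ (ihom A).obj K ≫ (ihom.ev A).app K := by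
  rw [dualUnit, leftUnitor_inv_naturality_assoc, MonoidalClosed.id_tensor_pre_app_comp_ev]

/-- In elements: `(a · φ)(1) = φ(a)`. The evaluation is thus recovered from the action and the form.
-/
lemma ihomAct_mul_dualUnit : ihomAct μ[A] K ≫ dualUnit A K = (ihom.ev A).app K := by
  rw [dualUnit_eq, leftUnitor_inv_naturality_assoc, whisker_exchange_assoc, ev_ihomAct_mul,
    associator_inv_naturality_left_assoc, ← comp_whiskerRight_assoc, MonObj.one_mul]
  simp

/-- Module morphisms to `D'(A)` are the same as morphisms to `K`. -/
lemma bijective_comp_dualUnit (T : Mod C A) :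
    Function.Bijective fun f : T ⟶ dualModule A K => f.hom ≫ dualUnit A K := by
  -- In elements, `f(t)(a) = f(at)(1)`: linearity determines `f` by its composite with the form.
  -- Conversely `φ` gives `t ↦ (a ↦ φ(at))`.
  have key (f : T ⟶ dualModule A K) :
      MonoidalClosed.uncurry (A := A) f.hom = act A T.X ≫ f.hom ≫ dualUnit A K := by
    have h : act A T.X ≫ f.hom = A ◁ f.hom ≫ ihomAct μ[A] K := act_hom f
    refine Eq.trans ?_ (h =≫ dualUnit A K).symm |>.trans (Category.assoc _ _ _)
    exact (A ◁ f.hom ≫= (ihomAct_mul_dualUnit A K).symm).trans (Category.assoc _ _ _).symm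
  refine ⟨fun f g h => Mod.hom_ext _ _ (MonoidalClosed.uncurry_injective (A := A) ?_),
    fun φ => ⟨Mod.Hom.mk' (MonoidalClosed.curry (act A T.X ≫ φ)) ?_, ?_⟩⟩
  · dsimp only at h
    rw [key, key, h]
  · change act A T.X ≫ MonoidalClosed.curry (act A T.X ≫ φ) =
      A ◁ MonoidalClosed.curry (act A T.X ≫ φ) ≫ ihomAct μ[A] K
    apply MonoidalClosed.uncurry_injective (A := A)
    rw [MonoidalClosed.uncurry_natural_left, MonoidalClosed.uncurry_curry,
      MonoidalClosed.uncurry_natural_left, MonoidalClosed.uncurry_eq, ev_ihomAct_mul,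
      associator_inv_naturality_right_assoc, whisker_exchange_assoc,
      MonoidalClosed.whiskerLeft_curry_ihom_ev_app]
    simp
  · change MonoidalClosed.curry (act A T.X ≫ φ) ≫ dualUnit A K = φ
    rw [dualUnit_eq, leftUnitor_inv_naturality_assoc, whisker_exchange_assoc,
      MonoidalClosed.whiskerLeft_curry_ihom_ev_app, ← Category.assoc (η[A] ▷ T.X), one_act]
    simp

end Coinduced

/-! ### Consequences of locality -/

section Local
variable {C : Type u} [Category.{v} C] [MonoidalCategory C] [BraidedCategory C]

/-- If `D'(A)` is local, then `K`-valued morphisms on `A ⊗ X` do not see the monodromy. -/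
lemma monodromy_comp_of_isLocal [MonoidalClosed C] {A : C} [MonObj A] [IsCommMonObj A] {K : C}
    (hA : isLocal A (dualModule A K)) {X : C} (q : A ⊗ X ⟶ K) :
    (β_ A X).hom ≫ (β_ X A).hom ≫ q = q := by
  have h : ihomAct μ[A] K = (β_ A ((ihom A).obj K)).hom ≫ (β_ ((ihom A).obj K) A).hom ≫
    ihomAct μ[A] K := hA
  -- `q` factors through the evaluation, that is, through the action on `D'(A)`, which absorbs the
  -- monodromy.
  have h' := A ◁ MonoidalClosed.curry q ≫= (h =≫ dualUnit A K)
  simp only [Category.assoc, ihomAct_mul_dualUnit] at h'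
  rw [BraidedCategory.braiding_naturality_right_assoc,
    BraidedCategory.braiding_naturality_left_assoc,
    MonoidalClosed.whiskerLeft_curry_ihom_ev_app] at h'
  exact h'.symm

variable {A : C} [MonObj A]

/-- The braiding descends to relative tensor products: `π ∘ c_{M,N}` is balanced. -/
lemma braiding_balanced {M N Q : C} [ModObj A M] [ModObj A N] (p : N ⊗ M ⟶ Q)
    (hN : act A N = (β_ A N).hom ≫ (β_ N A).hom ≫ act A N)
    (h : ((β_ N A).hom ≫ act A N) ▷ M ≫ p = (α_ N A M).hom ≫ N ◁ act A M ≫ p) :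
    ((β_ M A).hom ≫ act A M) ▷ N ≫ (β_ M N).hom ≫ p =
      (α_ M A N).hom ≫ M ◁ act A N ≫ (β_ M N).hom ≫ p := by
  -- Locality turns the left action on `N` into the right action preceded by a braiding, to which
  -- `h` applies.
  rw [BraidedCategory.braiding_naturality_right_assoc, hN, comp_whiskerRight_assoc _ _ M, h,
    BraidedCategory.braiding_tensor_right_hom, comp_whiskerRight, Category.assoc,
    BraidedCategory.braiding_naturality_left_assoc, BraidedCategory.braiding_tensor_left_hom]
  simp

/-- The inverse braiding descends to relative tensor products. -/
lemma braiding_inv_balanced {M N Q : C} [ModObj A M] [ModObj A N] (p : N ⊗ M ⟶ Q)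
    (hM : act A M = (β_ A M).hom ≫ (β_ M A).hom ≫ act A M)
    (h : ((β_ N A).hom ≫ act A N) ▷ M ≫ p = (α_ N A M).hom ≫ N ◁ act A M ≫ p) :
    ((β_ M A).hom ≫ act A M) ▷ N ≫ (β_ N M).inv ≫ p =
      (α_ M A N).hom ≫ M ◁ act A N ≫ (β_ N M).inv ≫ p := by
  have hM' : (β_ M A).hom ≫ act A M = (β_ A M).inv ≫ act A M := by
    rw [Iso.eq_inv_comp, ← hM]
  have hN : act A N ▷ M ≫ p =
      (β_ N A).inv ▷ M ≫ (α_ N A M).hom ≫ N ◁ act A M ≫ p := by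
    rw [← h, ← comp_whiskerRight_assoc, Iso.inv_hom_id_assoc]
  rw [BraidedCategory.braiding_inv_naturality_right_assoc, hN, hM', comp_whiskerRight,
    Category.assoc, BraidedCategory.braiding_inv_naturality_left_assoc,
    BraidedCategory.braiding_tensor_right_inv, BraidedCategory.braiding_tensor_left_inv]
  simp

/-- The braiding is `A`-linear after projection to the relative tensor product. -/
lemma act_braiding_of_balanced {M N Q : C} [ModObj A M] [ModObj A N] (p : N ⊗ M ⟶ Q)
    (hN : act A N = (β_ A N).hom ≫ (β_ N A).hom ≫ act A N)
    (h : ((β_ N A).hom ≫ act A N) ▷ M ≫ p = (α_ N A M).hom ≫ N ◁ act A M ≫ p) :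
    A ◁ (β_ M N).hom ≫ (α_ A N M).inv ≫ act A N ▷ M ≫ p =
      (α_ A M N).inv ≫ act A M ▷ N ≫ (β_ M N).hom ≫ p := by
  rw [BraidedCategory.braiding_naturality_left_assoc, hN, comp_whiskerRight_assoc _ _ M, h,
    BraidedCategory.braiding_tensor_left_hom]
  simp

end Local

/-! ### The braiding of local modules -/

section LocBraiding
variable {C : Type u} [Category.{v} C] [MonoidalCategory C] [BraidedCategory C]
  [MonoidalClosed C] [HasCoequalizers C] (A : C) [MonObj A] [IsCommMonObj A]

instance (M N : Mod C A) : Epi (modProj A M N) :=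
  inferInstanceAs (Epi (bimodProj ((toBimod A).obj M) ((toBimod A).obj N)))

instance (M N : Mod C A) (Z : C) : Epi (Z ◁ modProj A M N) :=
  inferInstanceAs (Epi (Z ◁ bimodProj ((toBimod A).obj M) ((toBimod A).obj N)))

instance (M N : Mod C A) (Z : C) : Epi (modProj A M N ▷ Z) :=
  inferInstanceAs (Epi (bimodProj ((toBimod A).obj M) ((toBimod A).obj N) ▷ Z))

instance : (LocMod.forget A).Faithful where
  map_injective h := ObjectProperty.hom_ext _ (Mod.hom_ext _ _ h)

lemma modProj_balanced (M N : Mod C A) :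
    ((β_ M.X A).hom ≫ act A M.X) ▷ N.X ≫ modProj A M N =
      (α_ M.X A N.X).hom ≫ M.X ◁ act A N.X ≫ modProj A M N :=
  (modProj_condition A M N).trans (Category.assoc _ _ _)

/-- The morphism out of `M ⊗_A N` induced by a balanced morphism. -/
noncomputable def modDesc {M N : Mod C A} {Q : C} (p : M.X ⊗ N.X ⟶ Q)
    (h : ((β_ M.X A).hom ≫ act A M.X) ▷ N.X ≫ p =
      (α_ M.X A N.X).hom ≫ M.X ◁ act A N.X ≫ p) : (M ⊗ N).X ⟶ Q :=
  Cofork.IsColimit.desc (modProjIsColimit A M N) p (h.trans (Category.assoc _ _ _).symm)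

lemma modProj_modDesc {M N : Mod C A} {Q : C} (p : M.X ⊗ N.X ⟶ Q)
    (h : ((β_ M.X A).hom ≫ act A M.X) ▷ N.X ≫ p =
      (α_ M.X A N.X).hom ≫ M.X ◁ act A N.X ≫ p) : modProj A M N ≫ modDesc A p h = p :=
  Cofork.IsColimit.π_desc' (modProjIsColimit A M N) p (h.trans (Category.assoc _ _ _).symm)

variable {A}

/-- The isomorphism `M ⊗_A N ≅ N ⊗_A M` underlying the braiding of local modules. -/
noncomputable def locBraidingIso (M N : LocMod A) : (M.obj ⊗ N.obj).X ≅ (N.obj ⊗ M.obj).X where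
  hom := modDesc A ((β_ M.obj.X N.obj.X).hom ≫ modProj A N.obj M.obj)
    (braiding_balanced _ N.property (modProj_balanced A _ _))
  inv := modDesc A ((β_ M.obj.X N.obj.X).inv ≫ modProj A M.obj N.obj)
    -- The lemma is used with the factors exchanged, so locality of `N` is again what is needed.
    (braiding_inv_balanced _ N.property (modProj_balanced A _ _))
  hom_inv_id := by
    rw [← cancel_epi (modProj A M.obj N.obj), ← Category.assoc, modProj_modDesc, Category.assoc,
      modProj_modDesc, Iso.hom_inv_id_assoc, Category.comp_id]
  inv_hom_id := by
    rw [← cancel_epi (modProj A N.obj M.obj), ← Category.assoc, modProj_modDesc, Category.assoc,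
      modProj_modDesc, Iso.inv_hom_id_assoc, Category.comp_id]

lemma modProj_locBraidingIso (M N : LocMod A) :
    modProj A M.obj N.obj ≫ (locBraidingIso M N).hom =
      (β_ M.obj.X N.obj.X).hom ≫ modProj A N.obj M.obj :=
  modProj_modDesc A _ (braiding_balanced _ N.property (modProj_balanced A _ _))

lemma act_locBraidingIso (M N : LocMod A) :
    act A (M.obj ⊗ N.obj).X ≫ (locBraidingIso M N).hom =
      A ◁ (locBraidingIso M N).hom ≫ act A (N.obj ⊗ M.obj).X := by
  rw [← cancel_epi (A ◁ modProj A M.obj N.obj), ← Category.assoc, modProj_act,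
    ← whiskerLeft_comp_assoc, modProj_locBraidingIso, whiskerLeft_comp, Category.assoc,
    Category.assoc, Category.assoc, modProj_locBraidingIso, modProj_act]
  exact (act_braiding_of_balanced _ N.property (modProj_balanced A _ _)).symm

/-- The braiding of local modules. -/
noncomputable def locBraiding (M N : LocMod A) : M ⊗ N ≅ N ⊗ M where
  hom := ObjectProperty.homMk (Mod.Hom.mk' (locBraidingIso M N).hom (act_locBraidingIso M N))
  inv := ObjectProperty.homMk (Mod.Hom.mk' (locBraidingIso M N).inv (by
    have := act_locBraidingIso M N
    change act A (N.obj ⊗ M.obj).X ≫ (locBraidingIso M N).inv =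
      A ◁ (locBraidingIso M N).inv ≫ act A (M.obj ⊗ N.obj).X
    rw [Iso.comp_inv_eq, Category.assoc, this, whiskerLeft_inv_hom_assoc]))
  hom_inv_id := (LocMod.forget A).map_injective (locBraidingIso M N).hom_inv_id
  inv_hom_id := (LocMod.forget A).map_injective (locBraidingIso M N).inv_hom_id

lemma μ_locBraiding (M N : LocMod A) :
    Functor.LaxMonoidal.μ (LocMod.forget A) M N ≫ (LocMod.forget A).map (locBraiding M N).hom =
      (β_ ((LocMod.forget A).obj M) ((LocMod.forget A).obj N)).hom ≫ Functor.LaxMonoidal.μ (LocMod.forget A) N M :=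
  modProj_locBraidingIso M N

variable (A) in
/-- Local modules form a braided monoidal category. -/
@[reducible]
noncomputable def locBraided : BraidedCategory (LocMod A) :=
  haveI (M N : LocMod A) : Epi (Functor.LaxMonoidal.μ (LocMod.forget A) M N) :=
    inferInstanceAs (Epi (modProj A M.obj N.obj))
  haveI (M N P : LocMod A) : Epi (Functor.LaxMonoidal.μ (LocMod.forget A) M N ▷ (LocMod.forget A).obj P) :=
    inferInstanceAs (Epi (modProj A M.obj N.obj ▷ P.obj.X))
  haveI (M N P : LocMod A) : Epi ((LocMod.forget A).obj P ◁ Functor.LaxMonoidal.μ (LocMod.forget A) M N) :=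
    inferInstanceAs (Epi (P.obj.X ◁ modProj A M.obj N.obj))
  braidedOfFaithfulLax (LocMod.forget A) locBraiding μ_locBraiding

end LocBraiding

/-! ### Transposing an action along a perfect pairing -/

section Transpose
variable {C : Type u} [Category.{v} C] [MonoidalCategory C] {A : C} [MonObj A] {K M N : C}
  [ModObj A N] {p : M ⊗ N ⟶ K} (hp : IsPerfect p)

/-- The right action on the first factor of a perfect pairing, transposed from a left action on the
second factor. -/
noncomputable def transposeAct : M ⊗ A ⟶ M :=
  ((hp.right (M ⊗ A)).2 ((α_ M A N).hom ≫ M ◁ act A N ≫ p)).choose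

/-- In elements, `p(ma, n) = p(m, an)`; this will also serve as the balancedness of `p`. -/
lemma transposeAct_pairing :
    transposeAct (A := A) hp ▷ N ≫ p = (α_ M A N).hom ≫ M ◁ act A N ≫ p :=
  ((hp.right (M ⊗ A)).2 ((α_ M A N).hom ≫ M ◁ act A N ≫ p)).choose_spec

lemma transposeAct_one : M ◁ η[A] ≫ transposeAct (A := A) hp = (ρ_ M).hom := by
  apply hp.right.hom_ext
  rw [comp_whiskerRight, Category.assoc, transposeAct_pairing, associator_naturality_middle_assoc,
    ← whiskerLeft_comp_assoc, one_act]
  simp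

lemma transposeAct_mul : M ◁ μ[A] ≫ transposeAct (A := A) hp =
    (α_ M A A).inv ≫ transposeAct (A := A) hp ▷ A ≫ transposeAct (A := A) hp := by
  apply hp.right.hom_ext
  simp only [comp_whiskerRight, Category.assoc, transposeAct_pairing]
  rw [associator_naturality_middle_assoc, ← whiskerLeft_comp_assoc, mul_act,
    associator_naturality_left_assoc, ← whisker_exchange_assoc, transposeAct_pairing]
  simp

/-- The transposed action on a local module is insensitive to the monodromy. -/
lemma monodromy_transposeAct [BraidedCategory C]
    (hN : act A N = (β_ A N).hom ≫ (β_ N A).hom ≫ act A N)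
    (hK : ∀ {X : C} (q : A ⊗ X ⟶ K), (β_ A X).hom ≫ (β_ X A).hom ≫ q = q) :
    (β_ M A).hom ≫ (β_ A M).hom ≫ transposeAct (A := A) hp = transposeAct (A := A) hp := by
  apply hp.right.hom_ext
  -- The inverse braiding is inserted to cancel the last crossing when the monodromy of `A` around
  -- `M ⊗ N` is expanded. The crossings with `N` are absorbed by `hN`.
  have h := hK ((α_ A M N).inv ≫ (β_ M A).inv ▷ N ≫ (α_ M A N).hom ≫ M ◁ act A N ≫ p)
  rw [BraidedCategory.braiding_tensor_right_hom, BraidedCategory.braiding_tensor_left_hom] at h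
  simp only [Category.assoc, Iso.hom_inv_id_assoc, Iso.inv_hom_id_assoc,
    hom_inv_whiskerRight_assoc, cancel_epi] at h
  rw [← whiskerLeft_comp_assoc, ← whiskerLeft_comp_assoc, Category.assoc, ← hN] at h
  simp only [comp_whiskerRight, Category.assoc, transposeAct_pairing, h,
    hom_inv_whiskerRight_assoc]

/-- The first factor of a perfect pairing as a left module, if the transposed right action is
insensitive to the monodromy. -/
@[reducible]
noncomputable def transposeModObj [BraidedCategory C] [IsCommMonObj A] : ModObj A M where
  smul := (β_ A M).hom ≫ transposeAct (A := A) hp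
  one_smul := by
    change η[A] ▷ M ≫ (β_ A M).hom ≫ transposeAct (A := A) hp = (λ_ M).hom
    rw [BraidedCategory.braiding_naturality_left_assoc, transposeAct_one, braiding_rightUnitor]
  mul_smul := by
    change μ[A] ▷ M ≫ (β_ A M).hom ≫ transposeAct (A := A) hp = (α_ A A M).hom ≫
      A ◁ ((β_ A M).hom ≫ transposeAct (A := A) hp) ≫ (β_ A M).hom ≫ transposeAct (A := A) hp
    -- Passing from a right to a left action reverses the order of multiplication; commutativity of
    -- `A` absorbs the resulting crossing.
    have h : M ◁ (β_ A A).hom ≫ (α_ M A A).inv ≫ transposeAct (A := A) hp ▷ A ≫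
        transposeAct (A := A) hp =
        (α_ M A A).inv ≫ transposeAct (A := A) hp ▷ A ≫ transposeAct (A := A) hp := by
      rw [← transposeAct_mul, ← whiskerLeft_comp_assoc, IsCommMonObj.mul_comm]
    rw [BraidedCategory.braiding_naturality_left_assoc, transposeAct_mul, whiskerLeft_comp,
      Category.assoc, BraidedCategory.braiding_naturality_right_assoc,
      BraidedCategory.braiding_tensor_left_hom, BraidedCategory.braiding_tensor_right_hom]
    simp [h]

end Transpose

/-! ### Pairings of local modules with values in `D'(A)` -/

section LocPairing
variable {C : Type u} [Category.{v} C] [MonoidalCategory C] [BraidedCategory C]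
  [MonoidalClosed C] [HasCoequalizers C] {A : C} [MonObj A] [IsCommMonObj A] {K : C}

/-- `D'(A)` as a local module. -/
def locDual (hA : isLocal A (dualModule A K)) : LocMod A := ⟨dualModule A K, hA⟩

variable (hA : isLocal A (dualModule A K))

/-- The pairing `M ⊗ N ⟶ K` in `C` induced by a morphism `M ⊗_A N ⟶ D'(A)`. -/
noncomputable abbrev locPairing {M N : LocMod A} (f : M ⊗ N ⟶ locDual hA) :
    M.obj.X ⊗ N.obj.X ⟶ K :=
  mapPairing (LocMod.forget A) (K := locDual hA) (dualUnit A K) f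

lemma locPairing_balanced {M N : LocMod A} (f : M ⊗ N ⟶ locDual hA) :
    ((β_ M.obj.X A).hom ≫ act A M.obj.X) ▷ N.obj.X ≫ locPairing hA f =
      (α_ M.obj.X A N.obj.X).hom ≫ M.obj.X ◁ act A N.obj.X ≫ locPairing hA f := by
  have h := modProj_balanced A M.obj N.obj =≫ (f.hom.hom ≫ dualUnit A K)
  simp only [Category.assoc] at h
  exact h

lemma locPairing_whiskerRight {M M' N : LocMod A} (g : M' ⟶ M) (f : M ⊗ N ⟶ locDual hA) :
    locPairing hA (g ▷ N ≫ f) = g.hom.hom ▷ N.obj.X ≫ locPairing hA f :=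
  mapPairing_whiskerRight _ _ _ _

lemma locPairing_whiskerLeft {M N N' : LocMod A} (g : N' ⟶ N) (f : M ⊗ N ⟶ locDual hA) :
    locPairing hA (M ◁ g ≫ f) = M.obj.X ◁ g.hom.hom ≫ locPairing hA f :=
  mapPairing_whiskerLeft _ _ _ _

lemma locPairing_braiding {M N : LocMod A} (f : M ⊗ N ⟶ locDual hA) :
    locPairing hA ((locBraiding N M).hom ≫ f) = (β_ N.obj.X M.obj.X).hom ≫ locPairing hA f := by
  have h := μ_locBraiding N M =≫ ((LocMod.forget A).map f ≫ dualUnit A K)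
  simp only [Category.assoc] at h
  exact (modProj A N.obj M.obj ≫= Category.assoc (locBraiding N M).hom.hom.hom f.hom.hom _).trans h

lemma locPairing_injective (M N : LocMod A) :
    Function.Injective fun f : M ⊗ N ⟶ locDual hA => locPairing hA f := by
  intro f g h
  have h' : modProj A M.obj N.obj ≫ f.hom.hom ≫ dualUnit A K =
    modProj A M.obj N.obj ≫ g.hom.hom ≫ dualUnit A K := h
  rw [cancel_epi] at h'
  exact ObjectProperty.hom_ext _ ((bijective_comp_dualUnit A K _).1 h')

/-- A balanced map descends to the coequalizer `M ⊗_A N`, and coinduction lifts the result to a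
module map into `D'(A)`. -/
lemma exists_locPairing_eq {M N : LocMod A} (p : M.obj.X ⊗ N.obj.X ⟶ K)
    (hp : ((β_ M.obj.X A).hom ≫ act A M.obj.X) ▷ N.obj.X ≫ p =
      (α_ M.obj.X A N.obj.X).hom ≫ M.obj.X ◁ act A N.obj.X ≫ p) :
    ∃ f : M ⊗ N ⟶ locDual hA, locPairing hA f = p := by
  obtain ⟨f, hf⟩ := (bijective_comp_dualUnit A K (M.obj ⊗ N.obj)).2 (modDesc A p hp)
  refine ⟨ObjectProperty.homMk f, ?_⟩
  change modProj A M.obj N.obj ≫ f.hom ≫ dualUnit A K = p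
  dsimp only at hf
  rw [hf, modProj_modDesc]

/-- A pairing of local modules with values in `D'(A)` is perfect if the induced pairing with values
in `K` is perfect. -/
lemma isPerfect_of_locPairing {M N : LocMod A} (f : M ⊗ N ⟶ locDual hA)
    (hf : IsPerfect (locPairing hA f)) : IsPerfect f := by
  have hb := locPairing_balanced hA f
  refine ⟨fun Z => ⟨fun g g' h => ?_, fun q => ?_⟩, fun Z => ⟨fun g g' h => ?_, fun q => ?_⟩⟩
  · apply (LocMod.forget A).map_injective
    refine hf.right.hom_ext (f := g.hom.hom) (g := g'.hom.hom) ?_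
    rw [← locPairing_whiskerRight, ← locPairing_whiskerRight]
    exact congrArg _ h
  · obtain ⟨g, hg⟩ := (hf.right Z.obj.X).2 (locPairing hA q)
    dsimp only at hg
    have hq := locPairing_balanced hA q
    -- Linearity is tested against the perfect pairing, after rewriting left actions as right ones:
    -- `p(g(za), n) = q(za, n) = q(z, an) = p(g(z), an) = p(g(z)a, n)`.
    have hl : act A Z.obj.X ≫ g = A ◁ g ≫ act A M.obj.X := by
      rw [← cancel_epi (β_ Z.obj.X A).hom, ← BraidedCategory.braiding_naturality_left_assoc]
      apply hf.right.hom_ext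
      rw [← hg] at hq
      rw [← Category.assoc, comp_whiskerRight_assoc _ g, hq, comp_whiskerRight_assoc (g ▷ A), hb,
        associator_naturality_left_assoc, whisker_exchange_assoc]
    refine ⟨ObjectProperty.homMk (Mod.Hom.mk' g hl), locPairing_injective hA _ _ ?_⟩
    exact (locPairing_whiskerRight hA _ _).trans hg
  · apply (LocMod.forget A).map_injective
    refine hf.left.hom_ext (f := g.hom.hom) (g := g'.hom.hom) ?_
    rw [← locPairing_whiskerLeft, ← locPairing_whiskerLeft]
    exact congrArg _ h
  · obtain ⟨g, hg⟩ := (hf.left Z.obj.X).2 (locPairing hA q)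
    dsimp only at hg
    have hq := locPairing_balanced hA q
    have hl : act A Z.obj.X ≫ g = A ◁ g ≫ act A N.obj.X := by
      apply hf.left.hom_ext
      rw [← cancel_epi (α_ M.obj.X A Z.obj.X).hom]
      rw [← hg] at hq
      rw [whiskerLeft_comp_assoc, ← hq, ← whisker_exchange_assoc, hb, whiskerLeft_comp_assoc,
        associator_naturality_right_assoc]
    refine ⟨ObjectProperty.homMk (Mod.Hom.mk' g hl), locPairing_injective hA _ _ ?_⟩
    exact (locPairing_whiskerLeft hA _ _).trans hg

/-- If `K` is dualizing, every local module is the second factor of a perfect pairing with values in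
`D'(A)`, which induces a perfect pairing in `C`. -/
lemma exists_isPerfect_locPairing (hK : IsDualizing K) (N : LocMod A) :
    ∃ (M : LocMod A) (f : M ⊗ N ⟶ locDual hA), IsPerfect f ∧ IsPerfect (locPairing hA f) := by
  obtain ⟨X, p, hp⟩ := hK.exists_isPerfect N.obj.X
  have hr := monodromy_transposeAct hp N.property (monodromy_comp_of_isLocal hA)
  let := transposeModObj (A := A) hp
  have hs : act A X = (β_ A X).hom ≫ transposeAct (A := A) hp := rfl
  -- The identity `hr` serves twice: it makes `M` local, and it identifies the right action of `M`
  -- with `transposeAct`, for which `p` is balanced.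
  let M : LocMod A := ⟨⟨X⟩, by
    change act A X = (β_ A X).hom ≫ (β_ X A).hom ≫ act A X
    rw [hs, hr]⟩
  obtain ⟨f, hf⟩ := exists_locPairing_eq hA (M := M) (N := N) p (by
    change ((β_ X A).hom ≫ act A X) ▷ N.obj.X ≫ p = (α_ X A N.obj.X).hom ≫ X ◁ act A N.obj.X ≫ p
    rw [hs, hr, transposeAct_pairing])
  have hf' : IsPerfect (locPairing hA f) := hf ▸ hp
  exact ⟨M, f, isPerfect_of_locPairing hA f hf', hf'⟩

end LocPairing

end GVCat

/-! ### The braided GV-structure on local modules -/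

theorem mainTheorem8 {C : Type u} [Category.{v} C] [MonoidalCategory C] [BraidedCategory C]
    [GVCategory C] [HasEqualizers C] [HasCoequalizers C] (A : C) [MonObj A] [IsCommMonObj A]
    (hA : isLocal A (dualModule A (dualizingObj C))) :
    ∃ (_ : BraidedCategory (LocMod A)) (_ : GVCategory (LocMod A))
      (hK : dualizingObj (LocMod A) = ⟨dualModule A (dualizingObj C), hA⟩),
      IsBraidedGVFunctor (LocMod.forget A)
        ((LocMod.forget A).map (eqToHom hK) ≫ dualUnit A (dualizingObj C)) := by
  have hp := exists_isPerfect_locPairing hA GVCategory.isDualizing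
  let := locBraided A
  let := GVCategory.ofIsDualizing (C := LocMod A) (K := locDual hA)
    (isDualizing_of_isPerfect fun N => let ⟨M, f, hf, _⟩ := hp N; ⟨M, f, hf⟩)
  refine ⟨locBraided A, this, rfl, ⟨?_, μ_locBraiding⟩⟩
  -- The identification of dualizing objects is `rfl`, so the form is the identity followed by
  -- `dualUnit`.
  refine (congrArg (fun υ => IsFrobeniusForm (LocMod.forget A) υ)
    (Category.id_comp (dualUnit A (dualizingObj C)))).mpr ?_
  refine isFrobeniusForm_of_isPerfect _ _ (fun N => ?_) (fun N => ?_)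
  · obtain ⟨M, f, hf, hf'⟩ := hp N
    exact ⟨M, f, hf.right, hf'.right⟩
  · obtain ⟨M, f, hf, hf'⟩ := hp N
    -- A pairing with `N` as first factor comes from braiding; `locPairing_braiding` matches its
    -- image with the braided pairing in `C`.
    exact ⟨M, (β_ N M).hom ≫ f, hf.braid.left,
      (congrArg LeftUniversal (locPairing_braiding hA f)).mpr hf'.braid.left⟩
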